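/- Let $F$ be a distribution function on $\mathbb R$, let $F^{\leftarrow}(p)=\inf\{x: F(x)>p\}$ for $0<p<1$, and let $M_n$ be the maximum of $n$ independent random variables with distribution function $F$. Say that $F$ belongs to a domain of max-attraction if there are real sequences $(a_n)$, $(b_n)$ with $a_n\neq 0$ such that $(M_n-b_n)/a_n$ converges in distribution to a nondegenerate probability law (one that is not a point mass). **Theorem 3.1 (de Haan, 1970).** $F$ belongs to a domain of max-attraction if and only if, for Lebesgue-almost all $(u,v)\in(0,\infty)^2$, the limit $$\lim_{\epsilon\downarrow 0}\frac{F^{\leftarrow}(1-\epsilon u)-F^{\leftarrow}(1-\epsilon)}{F^{\leftarrow}(1-\epsilon v)-F^{\leftarrow}(1-\epsilon)}\qquad(3.1)$$ exists as a finite real number (the denominator being nonzero for all sufficiently small $\epsilon>0$). Moreover, let $k_\rho(u)=(u^\rho-1)/\rho$ for $\rho\ne0$, $k_0(u)=\log u$, and let $\omega$ be a standard exponential random variable. If $F$ belongs to a domain of max-attraction, then there is a real number $\rho$ such that: 1. for all $u>0$ and all $v>0$ with $v\neq 1$, the limit (3.1) exists in the same sense and equals $k_\rho(u)/k_\rho(v)$;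 2. with $$a_n=F^{\leftarrow}(1-2/n)-F^{\leftarrow}(1-1/n),\qquad b_n=F^{\leftarrow}(1-1/n),\qquad(3.2)$$ which satisfy $a_n<0$ for all large $n$, $(M_n-b_n)/a_n$ converges in distribution to $k_\rho(\omega)/k_\rho(2)$; 3. with the same constants, for every real $x$, $P\{(M_n-b_n)/|a_n|\le x\}$ converges to - $\Phi_{-1/\rho}\bigl(1+(1-2^\rho)x\bigr)$ if $\rho<0$, - $\Lambda\bigl((\log 2)\,x\bigr)$ if $\rho=0$, - $\Psi_{1/\rho}\bigl((2^\rho-1)x-1\bigr)$ if $\rho>0$, where $\Phi_\alpha(x)=e^{-x^{-\alpha}}$ for $x>0$ and $0$ for $x\le 0$ (Fréchet), $\Lambda(x)=\exp(-e^{-x})$ (Gumbel), $\Psi_\alpha(x)=e^{-(-x)^{\alpha}}$ for $x<0$ and $1$ for $x\ge 0$ (Weibull); 4. whenever $(M_n-b'_n)/a'_n$, with $a'_n\neq0$, converges in distribution to a nondegenerate law, this law is that of $c\,k_\rho(\omega)+d$ for some real $c\neq0$ and $d$. -/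

import Mathlib

open MeasureTheory ProbabilityTheory Filter Set Topology

noncomputable section

/-- The right-continuous quantile function `F^←(p) = inf {x : F x > p}` of the distribution
function `F = cdf μ`; it is meaningful for `0 < p < 1`. -/
def quantile (μ : Measure ℝ) (p : ℝ) : ℝ := sInf {x : ℝ | p < cdf μ x}

/-- The maximum `M_n` of a sample of size `n ≥ 1`. -/
def sampleMax (n : ℕ) (x : Fin n → ℝ) : ℝ := ⨆ i, x i

/-- The law of `n` independent random variables with common law `μ`. -/
def sampleLaw (μ : Measure ℝ) (n : ℕ) : Measure (Fin n → ℝ) := Measure.pi fun _ => μ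

instance (μ : Measure ℝ) [IsProbabilityMeasure μ] (n : ℕ) :
    IsProbabilityMeasure (sampleLaw μ n) := by
  unfold sampleLaw; infer_instance

instance : IsProbabilityMeasure (expMeasure 1) := isProbabilityMeasure_expMeasure one_pos

/-- `(M_n - b_n) / a_n` converges in distribution to the random variable `Z`, which is defined on
the probability space `(ℝ, P)`; here `M_n` is the maximum of `n` independent random variables with
law `μ`. -/
def NormalizedMaxTendsto (μ : Measure ℝ) [IsProbabilityMeasure μ] (a b : ℕ → ℝ) (Z : ℝ → ℝ)
    (P : Measure ℝ) [IsProbabilityMeasure P] : Prop :=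
  TendstoInDistribution (fun (n : ℕ) (x : Fin n → ℝ) => (sampleMax n x - b n) / a n) atTop Z
    (fun n => sampleLaw μ n) P

/-- A law on the line is nondegenerate if it is not concentrated at one point. -/
def Nondegenerate (ν : Measure ℝ) : Prop := ∀ c : ℝ, ν ≠ Measure.dirac c

/-- `ν` is a nondegenerate limit law of `(M_n - b_n) / a_n`, with nonzero scales `a_n`. -/
def IsMaxLimit (μ : Measure ℝ) [IsProbabilityMeasure μ] (a b : ℕ → ℝ) (ν : Measure ℝ)
    [IsProbabilityMeasure ν] : Prop :=
  (∀ n, a n ≠ 0) ∧ Nondegenerate ν ∧ NormalizedMaxTendsto μ a b id ν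

/-- `F = cdf μ` belongs to a domain of max-attraction. -/
def InMaxDomain (μ : Measure ℝ) [IsProbabilityMeasure μ] : Prop :=
  ∃ (a b : ℕ → ℝ) (ν : Measure ℝ) (_ : IsProbabilityMeasure ν), IsMaxLimit μ a b ν

/-- As `ε → 0+`, the ratio
`(F^←(1 - εu) - F^←(1 - ε)) / (F^←(1 - εv) - F^←(1 - ε))` is defined for all small `ε`
(its denominator does not vanish) and converges to the real number `L`. -/
def QuantileRatioTendsto (μ : Measure ℝ) (u v L : ℝ) : Prop :=
  (∀ᶠ ε in 𝓝[>] (0 : ℝ), quantile μ (1 - ε * v) - quantile μ (1 - ε) ≠ 0) ∧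
  Tendsto (fun ε : ℝ => (quantile μ (1 - ε * u) - quantile μ (1 - ε)) /
      (quantile μ (1 - ε * v) - quantile μ (1 - ε))) (𝓝[>] 0) (𝓝 L)

/-- `k_ρ(u) = (u^ρ - 1) / ρ` for `ρ ≠ 0`, and `k_0 = log`. -/
def kFun (ρ u : ℝ) : ℝ := if ρ = 0 then Real.log u else (u ^ ρ - 1) / ρ

/-- The centering constants `b_n = F^←(1 - 1/n)`. -/
def normB (μ : Measure ℝ) (n : ℕ) : ℝ := quantile μ (1 - 1 / n)

/-- The scaling constants `a_n = F^←(1 - 2/n) - F^←(1 - 1/n)`; note that `a_n ≤ 0` for `n ≥ 3`. -/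
def normA (μ : Measure ℝ) (n : ℕ) : ℝ := quantile μ (1 - 2 / n) - quantile μ (1 - 1 / n)

/-- The Gumbel distribution function. -/
def gumbelCdf (x : ℝ) : ℝ := Real.exp (-Real.exp (-x))

/-- The Fréchet distribution function with index `α > 0`. -/
def frechetCdf (α x : ℝ) : ℝ := if x ≤ 0 then 0 else Real.exp (-x ^ (-α))

/-- The (reversed) Weibull distribution function with index `α > 0`. -/
def weibullCdf (α x : ℝ) : ℝ := if x < 0 then Real.exp (-(-x) ^ α) else 1

/-- The distribution function of the limit of `(M_n - b_n) / |a_n|` with the constants above: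
a Fréchet, Gumbel or Weibull distribution function, up to an increasing affine change of
variable, according to whether `ρ` is negative, zero or positive. -/
def limitCdf (ρ x : ℝ) : ℝ :=
  if ρ < 0 then frechetCdf (-1 / ρ) (1 + (1 - 2 ^ ρ) * x)
  else if ρ = 0 then gumbelCdf (Real.log 2 * x)
  else weibullCdf (1 / ρ) ((2 ^ ρ - 1) * x - 1)

end

/-! Write `Q s` for `expQuantile μ s`, the quantile at level `exp (-s)`. The maximum has
distribution function `F ^ n`, and `exp (-(s / n)) ^ n = exp (-s)`, so `M_n` has the law of `Q (ω /
n)` with `ω` standard exponential (`map_sampleMax`). Convergence in law of `(M_n - b_n) / a_n` with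
positive scales thus becomes convergence of the antitone functions `s ↦ (Q (s / n) - b_n) / a_n` at
the continuity points of the limit. Monotonicity (`tendsto_of_antitoneOn_of_dense`) allows moving
arguments there, and a dense set of points suffices.

Direct part. Scales of varying sign are made positive (`InMaxDomain.exists_pos_normalization`), and
`n = ⌊1/ε⌋` replaces the integers by a continuous `ε ↓ 0`. Normalizing `s ↦ Q (ε * (t * s))` at `ε`
and at `ε * t` gives, by convergence of types, a limit satisfying `h (t * s) = α * h s + β` with `α
> 0` depending on `t`. Monotonicity makes `h` continuous, hence an affine image of some `kFun ρ`.
Since `1 - ε * u = exp (-ε * τ)` with `τ → u`, the quantile ratios and the limit laws follow.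

Converse. By Fubini, one `v < 1` works for almost every `u`, hence for a dense set of `u`. The limit
in `u` extends to an antitone function, which is at least `1` on `(0, v)` and at most `0` on `(1,
∞)`, so the limit law is nondegenerate. -/

/-! ### Quantiles and the exponential representation -/

section Quantile

variable {μ : Measure ℝ} {p x : ℝ}

theorem bddBelow_lt_cdf (μ : Measure ℝ) (hp : 0 < p) : BddBelow {x : ℝ | p < cdf μ x} := by
  obtain ⟨y, hy⟩ := ((tendsto_cdf_atBot μ).eventually_lt_const hp).exists
  exact ⟨y, fun z hz => le_of_not_gt fun hzy =>
    (lt_of_lt_of_le hz (monotone_cdf μ hzy.le)).not_gt hy⟩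

theorem nonempty_lt_cdf (μ : Measure ℝ) (hp : p < 1) : {x : ℝ | p < cdf μ x}.Nonempty :=
  ((tendsto_cdf_atTop μ).eventually_const_lt hp).exists

theorem quantile_le (hp : 0 < p) (h : p < cdf μ x) : quantile μ p ≤ x :=
  csInf_le (bddBelow_lt_cdf μ hp) h

theorem le_quantile (hp : p < 1) (h : cdf μ x ≤ p) : x ≤ quantile μ p :=
  le_csInf (nonempty_lt_cdf μ hp) fun _ hy => le_of_not_gt fun hyx =>
    (lt_of_le_of_lt ((monotone_cdf μ hyx.le).trans h) hy).false

/-- By right continuity, `F x < p` would persist to the right of `x` and push the quantile strictly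
beyond `x`. -/
theorem le_cdf_of_quantile_le (hp : p < 1) (h : quantile μ p ≤ x) : p ≤ cdf μ x := by
  by_contra! hlt
  have h1 : ∀ᶠ y in 𝓝[>] x, cdf μ y < p :=
    (((cdf μ).right_continuous x).mono Ioi_subset_Ici_self).eventually_lt_const hlt
  obtain ⟨y, hy, hxy⟩ := (h1.and self_mem_nhdsWithin).exists
  exact ((le_quantile hp hy.le).trans h).not_gt hxy

theorem quantile_mono {q : ℝ} (hp : 0 < p) (hq : q < 1) (hpq : p ≤ q) :
    quantile μ p ≤ quantile μ q :=
  csInf_le_csInf (bddBelow_lt_cdf μ hp) (nonempty_lt_cdf μ hq) fun _ hx => hpq.trans_lt hx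

end Quantile

/-- The quantile transform of the exponential distribution: if `ω` is a standard exponential
variable, then `expQuantile μ ω` has law `μ`. -/
noncomputable def expQuantile (μ : Measure ℝ) (s : ℝ) : ℝ := quantile μ (Real.exp (-s))

theorem antitoneOn_expQuantile (μ : Measure ℝ) : AntitoneOn (expQuantile μ) (Ioi 0) :=
  fun s hs t _ hst => quantile_mono (Real.exp_pos _)
    (by simpa using hs) (by simpa using hst)

section Exponential

theorem expMeasure_absolutelyContinuous (r : ℝ) : expMeasure r ≪ volume :=
  withDensity_absolutelyContinuous _ _

theorem ae_pos_expMeasure : ∀ᵐ s ∂(expMeasure 1), 0 < s := by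
  have : expMeasure 1 (Iic 0) = 0 := by
    rw [← ofReal_cdf, cdf_expMeasure_eq one_pos]; simp
  rw [ae_iff]
  simpa [Iic] using this

theorem ae_expMeasure_of_countable {N : Set ℝ} (hN : N.Countable) :
    ∀ᵐ s ∂(expMeasure 1), s ∉ N :=
  (expMeasure_absolutelyContinuous 1).ae_le (hN.ae_notMem _)

theorem aemeasurable_expMeasure_of_antitoneOn {h : ℝ → ℝ} (hh : AntitoneOn h (Ioi 0)) :
    AEMeasurable h (expMeasure 1) := by
  rw [← Measure.restrict_eq_self_of_ae_mem (s := Ioi (0 : ℝ)) ae_pos_expMeasure]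
  exact aemeasurable_restrict_of_antitoneOn measurableSet_Ioi hh

/-- The variable `exp (-ω)` is uniform on the unit interval. -/
theorem expMeasure_real_exp_neg_lt {c : ℝ} (h0 : 0 ≤ c) (h1 : c ≤ 1) :
    (expMeasure 1).real {s | Real.exp (-s) < c} = c := by
  rcases h0.eq_or_lt with rfl | h0
  · simp [(Real.exp_pos _).not_gt]
  have hset : {s | Real.exp (-s) < c} = (Iic (-Real.log c))ᶜ := by
    ext s
    simp only [mem_ofPred_eq, mem_compl_iff, mem_Iic, not_le]
    rw [← Real.lt_log_iff_exp_lt h0]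
    constructor <;> intro h <;> linarith
  rw [hset, probReal_compl_eq_one_sub measurableSet_Iic, ← cdf_eq_real, cdf_expMeasure_eq one_pos,
    if_pos (by simpa using Real.log_nonpos h0.le h1)]
  simp [Real.exp_log h0]

end Exponential

theorem exp_neg_div_pow {n : ℕ} (hn : n ≠ 0) (s : ℝ) :
    Real.exp (-(s / n)) ^ n = Real.exp (-s) := by
  rw [← Real.exp_nat_mul]
  congr 1
  field_simp

theorem antitoneOn_expQuantile_div (μ : Measure ℝ) (n : ℕ) :
    AntitoneOn (fun s => expQuantile μ (s / n)) (Ioi 0) := by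
  rcases Nat.eq_zero_or_pos n with rfl | hn
  · simpa using antitoneOn_const
  · have hn' : (0 : ℝ) < n := by exact_mod_cast hn
    exact fun s hs t ht hst => antitoneOn_expQuantile μ (div_pos hs hn') (div_pos ht hn')
      (by gcongr)

/-- A law with distribution function `(cdf μ) ^ n` is that of `expQuantile μ (ω / n)`. -/
theorem eq_map_expQuantile_of_cdf_eq_pow {μ ν : Measure ℝ}
    [IsProbabilityMeasure ν] {n : ℕ} (hn : n ≠ 0) (h : ∀ x, cdf ν x = cdf μ x ^ n) :
    ν = (expMeasure 1).map (fun s => expQuantile μ (s / n)) := by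
  have hm := aemeasurable_expMeasure_of_antitoneOn (antitoneOn_expQuantile_div μ n)
  have := Measure.isProbabilityMeasure_map hm
  refine Measure.eq_of_cdf _ _ ?_
  ext x
  have hc0 := cdf_nonneg μ x
  have hc1 := cdf_le_one μ x
  rw [h, cdf_eq_real (Measure.map _ _), map_measureReal_apply_of_aemeasurable hm measurableSet_Iic,
    ← expMeasure_real_exp_neg_lt (pow_nonneg hc0 n) (pow_le_one₀ hc0 hc1)]
  refine measureReal_congr ?_
  -- The two events can differ only where `exp (-s) = F x ^ n`, which is at most one point `s`.
  filter_upwards [ae_pos_expMeasure,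
    ae_expMeasure_of_countable (countable_singleton (-Real.log (cdf μ x ^ n)))] with s hs hne
  have hs' : Real.exp (-(s / n)) < 1 := by
    have : (0 : ℝ) < n := by positivity
    simpa using div_pos hs this
  refine propext ?_
  change Real.exp (-s) < cdf μ x ^ n ↔ expQuantile μ (s / n) ≤ x
  rw [← exp_neg_div_pow hn, pow_lt_pow_iff_left₀ (Real.exp_pos _).le hc0 hn]
  refine ⟨fun hlt => quantile_le (Real.exp_pos _) hlt, fun hle => ?_⟩
  refine (le_cdf_of_quantile_le hs' hle).lt_of_ne fun heq => hne ?_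
  rw [mem_singleton_iff, ← heq, exp_neg_div_pow hn]
  simp

theorem eq_map_expQuantile (ν : Measure ℝ) [IsProbabilityMeasure ν] :
    ν = (expMeasure 1).map (expQuantile ν) := by
  simpa using eq_map_expQuantile_of_cdf_eq_pow (μ := ν) (ν := ν) one_ne_zero (by simp)

/-! ### The law of the sample maximum -/

theorem measurable_sampleMax (n : ℕ) : Measurable (sampleMax n) := by
  unfold sampleMax
  exact Measurable.iSup fun i => measurable_pi_apply i

theorem sampleMax_le_iff {n : ℕ} (hn : n ≠ 0) (y : Fin n → ℝ) (x : ℝ) :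
    sampleMax n y ≤ x ↔ ∀ i, y i ≤ x := by
  have : Nonempty (Fin n) := ⟨⟨0, Nat.pos_of_ne_zero hn⟩⟩
  exact ciSup_le_iff (Set.finite_range y).bddAbove

theorem sampleLaw_real_sampleMax_le (μ : Measure ℝ) [IsProbabilityMeasure μ] {n : ℕ} (hn : n ≠ 0)
    (x : ℝ) : (sampleLaw μ n).real {y | sampleMax n y ≤ x} = cdf μ x ^ n := by
  have : {y : Fin n → ℝ | sampleMax n y ≤ x} = Set.univ.pi fun _ => Iic x := by
    ext y; simp [sampleMax_le_iff hn, Pi.le_def]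
  rw [this, measureReal_def, sampleLaw, Measure.pi_pi]
  simp [cdf_eq_real, measureReal_def]

/-- The maximum of `n` independent variables with law `μ` is distributed as
`expQuantile μ (ω / n)`. -/
theorem map_sampleMax (μ : Measure ℝ) [IsProbabilityMeasure μ] {n : ℕ} (hn : n ≠ 0) :
    (sampleLaw μ n).map (sampleMax n) =
      (expMeasure 1).map (fun s => expQuantile μ (s / n)) := by
  have := Measure.isProbabilityMeasure_map (μ := sampleLaw μ n) (measurable_sampleMax n).aemeasurable
  refine eq_map_expQuantile_of_cdf_eq_pow hn fun x => ?_
  rw [cdf_eq_real, map_measureReal_apply (measurable_sampleMax n) measurableSet_Iic]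
  exact sampleLaw_real_sampleMax_le μ hn x

/-! ### Limits of monotone functions and convergence of types -/

/-- Pointwise convergence of antitone functions on a dense set, even along moving points, implies
convergence along moving points at each continuity point of the limit. -/
theorem tendsto_of_antitoneOn_of_dense {ι : Type*} {l : Filter ι} {H : ι → ℝ → ℝ} {h : ℝ → ℝ}
    {D : Set ℝ} (hD : Dense D) (hH : ∀ᶠ i in l, AntitoneOn (H i) (Ioi 0))
    (hlim : ∀ s ∈ D, 0 < s → ∃ σ : ι → ℝ, Tendsto σ l (𝓝 s) ∧
      Tendsto (fun i => H i (σ i)) l (𝓝 (h s)))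
    {s : ℝ} (hs : 0 < s) (hc : ContinuousAt h s) {τ : ι → ℝ} (hτ : Tendsto τ l (𝓝 s)) :
    Tendsto (fun i => H i (τ i)) l (𝓝 (h s)) := by
  refine tendsto_order.2 ⟨fun c hlt => ?_, fun c hlt => ?_⟩
  · obtain ⟨a, b, hab, hsub⟩ := mem_nhds_iff_exists_Ioo_subset.1 (hc.eventually_const_lt hlt)
    -- A point `r > s` of `D` where `h` still exceeds `c`: eventually `τ < σ`, so `H (τ)` is at
    -- least `H (σ)`, which exceeds `c`.
    obtain ⟨r, hrD, hr⟩ := hD.exists_between hab.2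
    obtain ⟨σ, hσ, hHσ⟩ := hlim r hrD (hs.trans hr.1)
    filter_upwards [hH, hHσ.eventually_const_lt (hsub ⟨hab.1.trans hr.1, hr.2⟩),
      hτ.eventually_lt hσ hr.1, hτ.eventually_const_lt hs] with i h1 h2 h3 h4
    exact h2.trans_le (h1 h4 (h4.trans h3) h3.le)
  · obtain ⟨a, b, hab, hsub⟩ := mem_nhds_iff_exists_Ioo_subset.1 (hc.eventually_lt_const hlt)
    obtain ⟨r, hrD, hr⟩ := hD.exists_between (max_lt hab.1 hs)
    have hr0 := (le_max_right _ _).trans_lt hr.1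
    obtain ⟨σ, hσ, hHσ⟩ := hlim r hrD hr0
    filter_upwards [hH, hHσ.eventually_lt_const
      (hsub ⟨(le_max_left _ _).trans_lt hr.1, hr.2.trans hab.2⟩),
      hσ.eventually_lt hτ hr.2, hσ.eventually_const_lt hr0] with i h1 h2 h3 h4
    exact (h1 h4 (h4.trans h3) h3.le).trans_lt h2

/-- Convergence of types: if the same functions converge to nonconstant limits under two
normalizations with positive scales, then the limits differ by a positive affine map. -/
theorem exists_affine_of_tendsto {ι : Type*} {l : Filter ι} [l.NeBot] {X : ι → ℝ → ℝ}
    {A B A' B' : ι → ℝ} (hA : ∀ᶠ i in l, 0 < A i) (hA' : ∀ᶠ i in l, 0 < A' i) {f g : ℝ → ℝ}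
    {D : Set ℝ} (hf : ∀ s ∈ D, Tendsto (fun i => (X i s - B i) / A i) l (𝓝 (f s)))
    (hg : ∀ s ∈ D, Tendsto (fun i => (X i s - B' i) / A' i) l (𝓝 (g s)))
    (hfn : ∃ s ∈ D, ∃ t ∈ D, f s ≠ f t) (hgn : ∃ s ∈ D, ∃ t ∈ D, g s ≠ g t) :
    ∃ α > 0, ∃ β, ∀ s ∈ D, g s = α * f s + β := by
  obtain ⟨s₁, hs₁, s₂, hs₂, hne⟩ := hfn
  have hf12 := (hf s₁ hs₁).sub (hf s₂ hs₂)
  have hg12 := (hg s₁ hs₁).sub (hg s₂ hs₂)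
  -- Increments between `s₁` and `s₂` do not involve the centerings, so their quotient isolates the
  -- ratio of scales.
  have hratio : Tendsto (fun i => A i / A' i) l (𝓝 ((g s₁ - g s₂) / (f s₁ - f s₂))) := by
    refine (hg12.div hf12 (sub_ne_zero.2 hne)).congr' ?_
    filter_upwards [hA, hA', hf12.eventually_ne (sub_ne_zero.2 hne)] with i h1 h2 h3
    have h4 : X i s₁ - X i s₂ ≠ 0 := by
      intro h
      apply h3
      rw [← sub_div]
      simp [h]
    rw [Pi.div_apply, ← sub_div, ← sub_div]
    simp only [sub_sub_sub_cancel_right]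
    field_simp
  set α := (g s₁ - g s₂) / (f s₁ - f s₂)
  have key : ∀ s ∈ D, g s = α * f s + (g s₁ - α * f s₁) := by
    intro s hs
    have h1 := hratio.mul ((hf s hs).sub (hf s₁ hs₁))
    have h2 := (hg s hs).sub (hg s₁ hs₁)
    have h3 := tendsto_nhds_unique_of_eventuallyEq h1 h2 (by
      filter_upwards [hA, hA'] with i h1 h2
      field_simp
      ring)
    linarith
  refine ⟨α, lt_of_le_of_ne ?_ ?_, _, key⟩
  · refine ge_of_tendsto hratio ?_
    filter_upwards [hA, hA'] with i h1 h2 using (div_pos h1 h2).le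
  -- A zero slope would make `g` constant on `D`.
  · rintro h0
    obtain ⟨s, hs, t, ht, hst⟩ := hgn
    exact hst (by rw [key s hs, key t ht, ← h0]; ring)

/-! ### Convergence in law and convergence of quantiles -/

theorem tendsto_real_le_of_tendstoInDistribution {ι Ω' : Type*} {Ω : ι → Type*}
    {m : ∀ i, MeasurableSpace (Ω i)} {mΩ' : MeasurableSpace Ω'} {X : ∀ i, Ω i → ℝ} {l : Filter ι}
    {Z : Ω' → ℝ} {μs : ∀ i, Measure (Ω i)} [∀ i, IsProbabilityMeasure (μs i)] {P : Measure Ω'}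
    [IsProbabilityMeasure P] (h : TendstoInDistribution X l Z μs P) {x : ℝ}
    (hx : P.map Z {x} = 0) :
    Tendsto (fun i => (μs i).real {ω | X i ω ≤ x}) l (𝓝 ((P.map Z).real (Iic x))) := by
  have := Measure.isProbabilityMeasure_map h.aemeasurable_limit
  have h1 := ProbabilityMeasure.tendsto_measure_of_null_frontier_of_tendsto' h.tendsto
    (E := Iic x) (by rw [frontier_Iic]; exact hx)
  have h2 := (ENNReal.tendsto_toReal (measure_ne_top (P.map Z) (Iic x))).comp h1
  refine h2.congr fun i => ?_
  exact map_measureReal_apply_of_aemeasurable (h.forall_aemeasurable i) measurableSet_Iic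

theorem exists_between_measure_singleton_eq_zero (ν : Measure ℝ) [IsFiniteMeasure ν] {x y : ℝ}
    (h : x < y) : ∃ z, ν {z} = 0 ∧ x < z ∧ z < y := by
  have hc : {z | 0 < ν {z}}.Countable := by
    refine Measure.countable_meas_pos_of_disjoint_iUnion (fun z => measurableSet_singleton z) ?_
    exact fun a b hab => by simpa using hab
  obtain ⟨z, hz, hz'⟩ := (hc.dense_compl ℝ).exists_between h
  exact ⟨z, by simpa using hz, hz'⟩

/-- At non-atoms `x` of the limit, `F (a_n * x + b_n) ^ n` converges; comparing it with `exp (-s)`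
and taking `n`-th roots compares `a_n * x + b_n` with `Q (s / n)`. The filter is general so that
indices can be restricted to one sign of the scale. -/
theorem tendsto_expQuantile_of_tendstoInDistribution {μ : Measure ℝ} [IsProbabilityMeasure μ]
    {l : Filter ℕ} (hl : l ≤ atTop) {a b : ℕ → ℝ} (ha : ∀ᶠ n in l, 0 < a n) {P : Measure ℝ}
    [IsProbabilityMeasure P] {Z : ℝ → ℝ}
    (h : TendstoInDistribution (fun (n : ℕ) (x : Fin n → ℝ) => (sampleMax n x - b n) / a n) l Z
      (fun n => sampleLaw μ n) P) {s : ℝ} (hs : 0 < s)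
    (hc : ContinuousAt (expQuantile (P.map Z)) s) :
    Tendsto (fun n : ℕ => (expQuantile μ (s / n) - b n) / a n) l
      (𝓝 (expQuantile (P.map Z) s)) := by
  have := Measure.isProbabilityMeasure_map h.aemeasurable_limit
  set ν := P.map Z with hν
  have hn0 : ∀ᶠ n : ℕ in l, n ≠ 0 := hl (eventually_ne_atTop 0)
  have hcdf : ∀ x, ν {x} = 0 →
      Tendsto (fun n : ℕ => cdf μ (a n * x + b n) ^ n) l (𝓝 (cdf ν x)) := by
    intro x hx
    rw [cdf_eq_real]
    refine (tendsto_real_le_of_tendstoInDistribution h hx).congr' ?_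
    filter_upwards [ha, hn0] with n hn hn0
    rw [← sampleLaw_real_sampleMax_le μ hn0]
    congr 1
    ext y
    change (sampleMax n y - b n) / a n ≤ x ↔ sampleMax n y ≤ a n * x + b n
    rw [div_le_iff₀ hn, sub_le_iff_le_add, mul_comm]
  have hexp : ∀ r : ℝ, 0 < r → Real.exp (-r) < 1 := fun r hr => by simpa using hr
  refine tendsto_order.2 ⟨fun c hlt => ?_, fun c hlt => ?_⟩
  · obtain ⟨p, q, hpq, hsub⟩ := mem_nhds_iff_exists_Ioo_subset.1 (hc.eventually_const_lt hlt)
    -- Continuity at `s` leaves room for `s' > s`, which makes the comparison with `exp (-s)`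
    -- strict.
    obtain ⟨s', hs'⟩ := exists_between hpq.2
    obtain ⟨x, hx0, hx⟩ := exists_between_measure_singleton_eq_zero ν
      (show c < expQuantile ν s' from hsub ⟨hpq.1.trans hs'.1, hs'.2⟩)
    have hG : cdf ν x < Real.exp (-s) := by
      refine lt_of_le_of_lt ?_ (Real.exp_lt_exp.2 (neg_lt_neg hs'.1))
      by_contra! hlt'
      exact (quantile_le (Real.exp_pos _) hlt').not_gt hx.2
    filter_upwards [ha, hn0, (hcdf x hx0).eventually_lt_const hG] with n h1 h2 h3
    rw [← exp_neg_div_pow h2] at h3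
    have h4 := lt_of_pow_lt_pow_left₀ n (Real.exp_pos _).le h3
    have h5 : a n * x + b n ≤ expQuantile μ (s / n) :=
      le_quantile (hexp _ (by positivity)) h4.le
    rw [lt_div_iff₀ h1]
    nlinarith [hx.1]
  · obtain ⟨p, q, hpq, hsub⟩ := mem_nhds_iff_exists_Ioo_subset.1 (hc.eventually_lt_const hlt)
    obtain ⟨s', hs'⟩ := exists_between (max_lt hpq.1 hs)
    have hs'0 := (le_max_right _ _).trans_lt hs'.1
    obtain ⟨x, hx0, hx⟩ := exists_between_measure_singleton_eq_zero ν
      (show expQuantile ν s' < c from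
        hsub ⟨(le_max_left _ _).trans_lt hs'.1, hs'.2.trans hpq.2⟩)
    have hG : Real.exp (-s) < cdf ν x :=
      (Real.exp_lt_exp.2 (neg_lt_neg hs'.2)).trans_le
        (le_cdf_of_quantile_le (hexp _ hs'0) hx.1.le)
    filter_upwards [ha, hn0, (hcdf x hx0).eventually_const_lt hG] with n h1 h2 h3
    rw [← exp_neg_div_pow h2] at h3
    have h4 := lt_of_pow_lt_pow_left₀ n (cdf_nonneg _ _) h3
    have h5 : expQuantile μ (s / n) ≤ a n * x + b n := quantile_le (Real.exp_pos _) h4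
    rw [div_lt_iff₀ h1]
    nlinarith [hx.2]

/-- A Skorokhod argument: all the maxima are represented on one exponential space, where almost sure
convergence implies convergence in law. -/
theorem normalizedMaxTendsto_of_ae_tendsto {μ : Measure ℝ} [IsProbabilityMeasure μ]
    {a b : ℕ → ℝ} {h : ℝ → ℝ} (hh : AEMeasurable h (expMeasure 1))
    (hlim : ∀ᵐ s ∂(expMeasure 1),
      Tendsto (fun n : ℕ => (expQuantile μ (s / n) - b n) / a n) atTop (𝓝 (h s))) :
    NormalizedMaxTendsto μ a b h (expMeasure 1) := by
  have hm : ∀ n : ℕ, AEMeasurable (fun s => expQuantile μ (s / n)) (expMeasure 1) := fun n =>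
    aemeasurable_expMeasure_of_antitoneOn (antitoneOn_expQuantile_div μ n)
  have key := tendstoInDistribution_of_ae_tendsto
    (fun n => ((hm n).sub_const (b n)).div_const (a n)) hh hlim
  refine ⟨fun n => (((measurable_sampleMax n).sub_const _).div_const _).aemeasurable, hh,
    key.tendsto.congr' ?_⟩
  filter_upwards [eventually_ne_atTop 0] with n hn
  refine Subtype.ext ?_
  have hg : Measurable fun x : ℝ => (x - b n) / a n := by fun_prop
  have h1 := AEMeasurable.map_map_of_aemeasurable (μ := expMeasure 1) hg.aemeasurable (hm n)
  have h2 := Measure.map_map (μ := sampleLaw μ n) hg (measurable_sampleMax n)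
  exact h1.symm.trans ((congrArg _ (map_sampleMax μ hn).symm).trans h2)

theorem countable_not_continuousAt_of_antitoneOn {h : ℝ → ℝ} (hh : AntitoneOn h (Ioi 0)) :
    {s | 0 < s ∧ ¬ContinuousAt h s}.Countable := by
  refine Set.Countable.mono (fun s hs => ?_) hh.countable_not_continuousWithinAt
  exact ⟨hs.1, fun hc => hs.2 (hc.continuousAt (Ioi_mem_nhds hs.1))⟩

theorem dense_continuousAt_of_antitoneOn {h g : ℝ → ℝ} (hh : AntitoneOn h (Ioi 0))
    (hg : AntitoneOn g (Ioi 0)) :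
    Dense {s | 0 < s → ContinuousAt h s ∧ ContinuousAt g s} := by
  refine (((countable_not_continuousAt_of_antitoneOn hh).union
    (countable_not_continuousAt_of_antitoneOn hg)).dense_compl ℝ).mono fun s hs hs0 => ?_
  simp only [mem_compl_iff, mem_union, mem_ofPred_eq, hs0, true_and, not_or, not_not] at hs
  exact hs

/-- Supplies the nonconstancy on `D` that convergence of types requires. -/
theorem exists_ne_of_dense {h : ℝ → ℝ} (hh : AntitoneOn h (Ioi 0))
    (hn : ∃ p > 0, ∃ q > 0, h q < h p) {D : Set ℝ} (hD : Dense D) :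
    ∃ s ∈ {s ∈ D | 0 < s}, ∃ t ∈ {s ∈ D | 0 < s}, h s ≠ h t := by
  obtain ⟨p, hp, q, hq, hlt⟩ := hn
  have hpq : p < q := lt_of_not_ge fun hqp => (hh hq hp hqp).not_gt hlt
  obtain ⟨s, hsD, hs⟩ := hD.exists_between hp
  obtain ⟨t, htD, ht⟩ := hD.exists_between (lt_add_one q)
  have ht0 := lt_trans hq ht.1
  refine ⟨s, ⟨hsD, hs.1⟩, t, ⟨htD, ht0⟩, ne_of_gt ?_⟩
  exact (hh hq ht0 ht.1.le).trans_lt (hlt.trans_le (hh hs.1 hp hs.2.le))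

/-- If the quantile transform were constant, its law `ν` would be a point mass. -/
theorem Nondegenerate.exists_expQuantile_lt {ν : Measure ℝ} [IsProbabilityMeasure ν]
    (h : Nondegenerate ν) : ∃ p > 0, ∃ q > 0, expQuantile ν q < expQuantile ν p := by
  by_contra! hc
  apply h (expQuantile ν 1)
  have : (expQuantile ν) =ᵐ[expMeasure 1] fun _ => expQuantile ν 1 := by
    filter_upwards [ae_pos_expMeasure] with s hs
    exact le_antisymm (hc s hs 1 one_pos) (hc 1 one_pos s hs)
  conv_lhs => rw [eq_map_expQuantile ν, Measure.map_congr this]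
  simp

theorem Nondegenerate.map_neg {ν : Measure ℝ} (h : Nondegenerate ν) :
    Nondegenerate (ν.map Neg.neg) := by
  intro c hc
  apply h (-c)
  have := congrArg (Measure.map Neg.neg) hc
  rwa [Measure.map_map measurable_neg measurable_neg, Measure.map_dirac' measurable_neg,
    show (Neg.neg ∘ Neg.neg : ℝ → ℝ) = id from funext neg_neg, Measure.map_id] at this

theorem antitoneOn_normalize {X : ℝ → ℝ} (hX : AntitoneOn X (Ioi 0)) {A : ℝ} (hA : 0 < A)
    (B : ℝ) : AntitoneOn (fun s => (X s - B) / A) (Ioi 0) := fun s hs t ht hst => by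
  have := hX hs ht hst
  dsimp only
  gcongr

/-! ### Reduction to positive scales and a continuous parameter -/

section MaxLimit

variable {μ ν : Measure ℝ} [IsProbabilityMeasure μ] [IsProbabilityMeasure ν] {a b : ℕ → ℝ}

theorem IsMaxLimit.tendsto_of_pos (h : IsMaxLimit μ a b ν) {l : Filter ℕ} (hl : l ≤ atTop)
    (ha : ∀ᶠ n in l, 0 < a n) {s : ℝ} (hs : 0 < s) (hc : ContinuousAt (expQuantile ν) s) :
    Tendsto (fun n : ℕ => (expQuantile μ (s / n) - b n) / a n) l (𝓝 (expQuantile ν s)) := by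
  obtain ⟨-, -, h⟩ := h
  have h' : TendstoInDistribution (fun (n : ℕ) (x : Fin n → ℝ) => (sampleMax n x - b n) / a n) l id
      (fun n => sampleLaw μ n) ν :=
    ⟨h.forall_aemeasurable, h.aemeasurable_limit, h.tendsto.mono_left hl⟩
  simpa using tendsto_expQuantile_of_tendstoInDistribution hl ha h' hs (by simpa using hc)

theorem IsMaxLimit.tendsto_of_neg (h : IsMaxLimit μ a b ν) {l : Filter ℕ} (hl : l ≤ atTop)
    (ha : ∀ᶠ n in l, a n < 0) {s : ℝ} (hs : 0 < s)
    (hc : ContinuousAt (expQuantile (ν.map Neg.neg)) s) :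
    Tendsto (fun n : ℕ => (expQuantile μ (s / n) - b n) / -a n) l
      (𝓝 (expQuantile (ν.map Neg.neg) s)) := by
  obtain ⟨-, -, h⟩ := h
  have h := h.continuous_comp continuous_neg
  have h' : TendstoInDistribution (fun (n : ℕ) (x : Fin n → ℝ) => (sampleMax n x - b n) / -a n) l
      Neg.neg (fun n => sampleLaw μ n) ν := by
    refine ⟨?_, measurable_neg.aemeasurable, ?_⟩
    · simpa only [Function.comp_def, div_neg] using h.forall_aemeasurable
    · simpa only [Function.comp_def, div_neg, id] using h.tendsto.mono_left hl
  exact tendsto_expQuantile_of_tendstoInDistribution hl (ha.mono fun n hn => neg_pos.2 hn) h' hs hc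

/-- Otherwise positivity at one late index would propagate to all later ones. -/
theorem frequently_sign_change {a : ℕ → ℝ} (ha : ∀ n, a n ≠ 0) (hp : ∃ᶠ n in atTop, 0 < a n)
    (hn : ∃ᶠ n in atTop, a n < 0) : ∃ᶠ n in atTop, 0 < a n ∧ a (n + 1) < 0 := by
  by_contra hc
  rw [not_frequently] at hc
  obtain ⟨N, hN⟩ := eventually_atTop.1 hc
  obtain ⟨m, hm, hpos⟩ := frequently_atTop.1 hp N
  obtain ⟨k, hk, hneg⟩ := frequently_atTop.1 hn m
  have : ∀ k ≥ m, 0 < a k := by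
    intro k hk
    induction k, hk using Nat.le_induction with
    | base => exact hpos
    | succ k hk ih =>
      exact lt_of_le_of_ne (not_lt.1 fun hlt => hN k (hm.trans hk) ⟨ih, hlt⟩) (ha _).symm
  exact (this k hk).not_gt hneg

/-- At a sign change, `M_n` and `M_{n+1}` are normalized with opposite signs, yet `Q (s / n)` and `Q
(s / (n + 1))` are asymptotically interchangeable. Convergence of types along the sign changes then
relates `ν` to its reflection. -/
theorem IsMaxLimit.exists_affine_map_neg (h : IsMaxLimit μ a b ν)
    (hp : ∃ᶠ n in atTop, 0 < a n) (hn : ∃ᶠ n in atTop, a n < 0) :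
    ∃ α > 0, ∃ β, ∀ s, 0 < s → ContinuousAt (expQuantile ν) s →
      ContinuousAt (expQuantile (ν.map Neg.neg)) s →
      expQuantile (ν.map Neg.neg) s = α * expQuantile ν s + β := by
  have : IsProbabilityMeasure (ν.map Neg.neg) :=
    Measure.isProbabilityMeasure_map measurable_neg.aemeasurable
  set g := expQuantile (ν.map Neg.neg) with hg
  have hD := dense_continuousAt_of_antitoneOn (antitoneOn_expQuantile ν)
    (antitoneOn_expQuantile (ν.map Neg.neg))
  set l : Filter ℕ := atTop ⊓ 𝓟 {n | 0 < a n ∧ a (n + 1) < 0} with hl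
  have : l.NeBot := frequently_mem_iff_neBot.1 (frequently_sign_change h.1 hp hn)
  have hlt : l ≤ atTop := inf_le_left
  have hmem : ∀ᶠ n in l, 0 < a n ∧ a (n + 1) < 0 := mem_inf_of_right (mem_principal_self _)
  have hgt : ∀ s, 0 < s → ContinuousAt g s →
      Tendsto (fun n : ℕ => (expQuantile μ (s / (n + 1 : ℕ)) - b (n + 1)) / -a (n + 1)) l
        (𝓝 (g s)) := fun s hs hc =>
    (h.tendsto_of_neg (l := l.map (· + 1)) ((map_mono hlt).trans (tendsto_add_atTop_nat 1))
      (eventually_map.2 (hmem.mono fun n hn => hn.2)) hs hc).comp tendsto_map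
  have key := exists_affine_of_tendsto (l := l) (X := fun n s => expQuantile μ (s / n))
    (A := a) (B := b) (A' := fun n => -a (n + 1)) (B' := fun n => b (n + 1))
    (f := expQuantile ν) (g := g) (D := {s ∈ {s | 0 < s → ContinuousAt (expQuantile ν) s ∧
      ContinuousAt g s} | 0 < s})
    (hmem.mono fun n hn => hn.1) (hmem.mono fun n hn => neg_pos.2 hn.2)
    (fun s hs => h.tendsto_of_pos hlt (hmem.mono fun n hn => hn.1) hs.2 (hs.1 hs.2).1) ?_
    (exists_ne_of_dense (antitoneOn_expQuantile ν) h.2.1.exists_expQuantile_lt hD)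
    (exists_ne_of_dense (antitoneOn_expQuantile _) h.2.1.map_neg.exists_expQuantile_lt hD)
  · obtain ⟨α, hα, β, hβ⟩ := key
    exact ⟨α, hα, β, fun s hs h1 h2 => hβ s ⟨fun _ => ⟨h1, h2⟩, hs⟩⟩
  · intro s hs
    -- `s / n = τ / (n + 1)` with `τ → s`, so the limit along `n + 1` is evaluated at a moving
    -- point.
    have hτ : Tendsto (fun n : ℕ => s / n * (n + 1 : ℕ)) l (𝓝 s) := by
      have h1 : Tendsto (fun n : ℕ => s * ((1 : ℝ) + 1 / (n : ℝ))) l (𝓝 (s * (1 + 0))) :=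
        ((tendsto_one_div_atTop_nhds_zero_nat.mono_left hlt).const_add 1).const_mul s
      rw [add_zero, mul_one] at h1
      refine h1.congr' ?_
      filter_upwards [hlt (eventually_ne_atTop 0)] with n hn
      have : (n : ℝ) ≠ 0 := by exact_mod_cast hn
      push_cast
      field_simp
    have := tendsto_of_antitoneOn_of_dense (l := l) (h := g)
      (H := fun n s => (expQuantile μ (s / (n + 1 : ℕ)) - b (n + 1)) / -a (n + 1)) hD
      (hmem.mono fun n hn => antitoneOn_normalize (antitoneOn_expQuantile_div μ (n + 1))
        (neg_pos.2 hn.2) _)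
      (fun r hr hr0 => ⟨fun _ => r, tendsto_const_nhds, hgt r hr0 (hr hr0).2⟩)
      hs.2 (hs.1 hs.2).2 hτ
    refine this.congr fun n => ?_
    rw [mul_div_assoc, div_self (by positivity), mul_one]

/-- The maxima of a law in a max-domain can be normalized with positive scales. -/
theorem InMaxDomain.exists_pos_normalization (hμ : InMaxDomain μ) :
    ∃ (A B : ℕ → ℝ) (h : ℝ → ℝ), (∀ n, 0 < A n) ∧ AntitoneOn h (Ioi 0) ∧
      (∃ p > 0, ∃ q > 0, h q < h p) ∧ ∀ s, 0 < s → ContinuousAt h s →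
        Tendsto (fun n : ℕ => (expQuantile μ (s / n) - B n) / A n) atTop (𝓝 (h s)) := by
  obtain ⟨a, b, ν, _, h⟩ := hμ
  have : IsProbabilityMeasure (ν.map Neg.neg) :=
    Measure.isProbabilityMeasure_map measurable_neg.aemeasurable
  by_cases hp : ∃ᶠ n in atTop, 0 < a n
  swap
  · have hneg : ∀ᶠ n in atTop, a n < 0 := (not_frequently.1 hp).mono fun n hn =>
      lt_of_le_of_ne (not_lt.1 hn) (h.1 n)
    refine ⟨fun n => |a n|, b, expQuantile (ν.map Neg.neg), fun n => abs_pos.2 (h.1 n),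
      antitoneOn_expQuantile _, h.2.1.map_neg.exists_expQuantile_lt, fun s hs hc => ?_⟩
    refine (h.tendsto_of_neg le_rfl hneg hs hc).congr' ?_
    filter_upwards [hneg] with n hn
    rw [abs_of_neg hn]
  by_cases hn : ∃ᶠ n in atTop, a n < 0
  swap
  · have hpos : ∀ᶠ n in atTop, 0 < a n := (not_frequently.1 hn).mono fun n hn =>
      lt_of_le_of_ne (not_lt.1 hn) (h.1 n).symm
    refine ⟨fun n => |a n|, b, expQuantile ν, fun n => abs_pos.2 (h.1 n),
      antitoneOn_expQuantile _, h.2.1.exists_expQuantile_lt, fun s hs hc => ?_⟩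
    refine (h.tendsto_of_pos le_rfl hpos hs hc).congr' ?_
    filter_upwards [hpos] with n hn
    rw [abs_of_pos hn]
  obtain ⟨α, hα, β, hαβ⟩ := h.exists_affine_map_neg hp hn
  have hneg : ∀ n, ¬0 < a n → a n < 0 := fun n hn => lt_of_le_of_ne (not_lt.1 hn) (h.1 n)
  have hA : ∀ n, 0 < if 0 < a n then a n else α * -a n := by
    intro n
    split_ifs with h0
    · exact h0
    · exact mul_pos hα (neg_pos.2 (hneg n h0))
  -- For negative `a n`, the limit under `-a n` is `α * f + β`, where `f = expQuantile ν`; rescaling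
  -- by `α` and shifting by `β * -a n` restores `f`.
  refine ⟨fun n => if 0 < a n then a n else α * -a n,
    fun n => if 0 < a n then b n else b n + β * -a n, expQuantile ν, hA,
    antitoneOn_expQuantile _, h.2.1.exists_expQuantile_lt, fun s hs hc => ?_⟩
  refine tendsto_of_antitoneOn_of_dense (l := atTop) (H := fun (n : ℕ) s => (expQuantile μ (s / n) -
      if 0 < a n then b n else b n + β * -a n) / if 0 < a n then a n else α * -a n)
    (dense_continuousAt_of_antitoneOn (antitoneOn_expQuantile ν)
      (antitoneOn_expQuantile (ν.map Neg.neg)))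
    (Eventually.of_forall fun n => antitoneOn_normalize (antitoneOn_expQuantile_div μ n) (hA n) _)
    (fun r hr hr0 => ⟨fun _ => r, tendsto_const_nhds, ?_⟩) hs hc tendsto_const_nhds
  have h1 := h.tendsto_of_pos (l := atTop ⊓ 𝓟 {n | 0 < a n}) inf_le_left
    (mem_inf_of_right (mem_principal_self _)) hr0 (hr hr0).1
  have h2 := h.tendsto_of_neg (l := atTop ⊓ 𝓟 {n | ¬0 < a n}) inf_le_left
    (mem_inf_of_right (mem_principal.2 fun n hn => hneg n hn)) hr0 (hr hr0).2
  have h3 := (h2.sub_const β).div_const α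
  rw [hαβ r hr0 (hr hr0).1 (hr hr0).2, add_sub_cancel_right, mul_div_cancel_left₀ _ hα.ne'] at h3
  refine (h1.if h3).congr fun n => ?_
  split_ifs with h0
  · rfl
  · have := (hneg n h0).ne
    field_simp
    ring

theorem InMaxDomain.exists_tendsto_nhdsGT (hμ : InMaxDomain μ) :
    ∃ (A B h : ℝ → ℝ), (∀ ε, 0 < A ε) ∧ AntitoneOn h (Ioi 0) ∧
      (∃ p > 0, ∃ q > 0, h q < h p) ∧ ∀ s, 0 < s → ContinuousAt h s → ∀ τ : ℝ → ℝ,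
        Tendsto τ (𝓝[>] 0) (𝓝 s) →
        Tendsto (fun ε : ℝ => (expQuantile μ (ε * τ ε) - B ε) / A ε) (𝓝[>] 0) (𝓝 (h s)) := by
  obtain ⟨A, B, h, hA, hh, hn, hlim⟩ := hμ.exists_pos_normalization
  have hfl : Tendsto (fun ε : ℝ => ⌊ε⁻¹⌋₊) (𝓝[>] 0) atTop :=
    tendsto_nat_floor_atTop.comp tendsto_inv_nhdsGT_zero
  refine ⟨fun ε => A ⌊ε⁻¹⌋₊, fun ε => B ⌊ε⁻¹⌋₊, h, fun ε => hA _, hh, hn, fun s hs hc τ hτ => ?_⟩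
  -- With `n = ⌊ε⁻¹⌋₊`, one has `ε * τ = (τ * (n / ε⁻¹)) / n`, and `n / ε⁻¹ → 1`.
  have h1 : Tendsto (fun ε : ℝ => τ ε * (⌊ε⁻¹⌋₊ / ε⁻¹)) (𝓝[>] 0) (𝓝 (s * 1)) :=
    hτ.mul ((tendsto_nat_floor_div_atTop (R := ℝ)).comp tendsto_inv_nhdsGT_zero)
  rw [mul_one] at h1
  refine (tendsto_of_antitoneOn_of_dense (l := 𝓝[>] (0 : ℝ)) (h := h)
    (H := fun ε s => (expQuantile μ (s / (⌊ε⁻¹⌋₊ : ℕ)) - B ⌊ε⁻¹⌋₊) / A ⌊ε⁻¹⌋₊)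
    (dense_continuousAt_of_antitoneOn hh hh)
    (Eventually.of_forall fun ε => antitoneOn_normalize (antitoneOn_expQuantile_div μ _) (hA _) _)
    (fun r hr hr0 => ⟨fun _ => r, tendsto_const_nhds, (hlim r hr0 (hr hr0).1).comp hfl⟩)
    hs hc h1).congr' ?_
  filter_upwards [hfl.eventually_ne_atTop 0] with ε hε
  have : (⌊ε⁻¹⌋₊ : ℝ) ≠ 0 := by exact_mod_cast hε
  congr 3
  rw [div_inv_eq_mul, ← mul_assoc, mul_right_comm, mul_div_assoc, div_self this, mul_one, mul_comm]

end MaxLimit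

/-! ### The affine dilation equation -/

/-- An antitone function has a continuity point `s₁`, and the dilation taking `s₁` to `s₀` carries
continuity along. The equation is known only off a countable set; monotonicity fills the gaps. -/
theorem continuousAt_of_affine_dilation {h : ℝ → ℝ} (hh : AntitoneOn h (Ioi 0))
    (hfe : ∀ t > 0, ∃ α β, ∀ s > 0, ContinuousAt h s → ContinuousAt h (t * s) →
      h (t * s) = α * h s + β) {s₀ : ℝ} (hs₀ : 0 < s₀) : ContinuousAt h s₀ := by
  obtain ⟨s₁, hs₁, hs₁0, -⟩ := (dense_continuousAt_of_antitoneOn hh hh).exists_between one_pos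
  have ht : 0 < s₀ / s₁ := div_pos hs₀ hs₁0
  obtain ⟨α, β, hαβ⟩ := hfe _ ht
  have hdiv : s₀ / (s₀ / s₁) = s₁ := by field_simp
  have hcont : ContinuousAt (fun x => h (x / (s₀ / s₁))) s₀ := by
    refine ContinuousAt.comp (g := h) ?_ (by fun_prop)
    rw [hdiv]
    exact (hs₁ hs₁0).1
  have hcount : (((fun x => x / (s₀ / s₁)) ⁻¹' {s | 0 < s ∧ ¬ContinuousAt h s}) ∪
      {s | 0 < s ∧ ¬ContinuousAt h s}).Countable :=
    ((countable_not_continuousAt_of_antitoneOn hh).preimage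
      (fun x y hxy => (div_left_inj' ht.ne').1 hxy)).union (countable_not_continuousAt_of_antitoneOn hh)
  refine continuousAt_of_tendsto_nhds (y := α * h (s₀ / (s₀ / s₁)) + β) ?_
  refine tendsto_of_antitoneOn_of_dense (l := 𝓝 s₀) (H := fun _ => h)
    (h := fun x => α * h (x / (s₀ / s₁)) + β) (hcount.dense_compl ℝ)
    (Eventually.of_forall fun _ => hh) (fun r hr hr0 => ⟨fun _ => r, tendsto_const_nhds, ?_⟩)
    hs₀ ((hcont.const_mul α).add_const β) tendsto_id
  have hr' : 0 < r / (s₀ / s₁) := div_pos hr0 ht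
  simp only [mem_compl_iff, mem_union, mem_preimage, mem_ofPred_eq, hr0, hr', true_and, not_or,
    not_not] at hr
  have hmul : s₀ / s₁ * (r / (s₀ / s₁)) = r := mul_div_cancel₀ _ ht.ne'
  have := hαβ _ hr' hr.1 (by rw [hmul]; exact hr.2)
  rw [hmul] at this
  rw [← this]
  exact tendsto_const_nhds

/-- The continuous solutions of the affine dilation equation are the affine images of the
functions `kFun ρ`. -/
theorem exists_eq_kFun {h : ℝ → ℝ} (hc : ∀ s > 0, ContinuousAt h s)
    (hn : ∃ p > 0, ∃ q > 0, h q < h p)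
    (hfe : ∀ t > 0, ∃ α > 0, ∃ β, ∀ s > 0, h (t * s) = α * h s + β) :
    ∃ ρ C d, C ≠ 0 ∧ ∀ s > 0, h s = C * kFun ρ s + d := by
  choose! α hα β hαβ using hfe
  -- Logarithmic coordinates turn the equation into the cocycle identity `f (x + y) = a x * f y + f
  -- x`.
  set f : ℝ → ℝ := fun x => h (Real.exp x) - h 1 with hf
  set a : ℝ → ℝ := fun x => α (Real.exp x) with ha
  have ha0 : ∀ x, 0 < a x := fun x => hα _ (Real.exp_pos x)
  have hfc : Continuous f := by
    refine Continuous.sub (continuous_iff_continuousAt.2 fun x => ?_) continuous_const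
    exact ContinuousAt.comp (g := h) (hc _ (Real.exp_pos x)) Real.continuous_exp.continuousAt
  have hadd : ∀ x y, f (x + y) = a x * f y + f x := by
    intro x y
    have h1 := hαβ _ (Real.exp_pos x) _ (Real.exp_pos y)
    have h2 := hαβ _ (Real.exp_pos x) 1 one_pos
    rw [mul_one] at h2
    simp only [hf, ha, Real.exp_add, h1, h2]
    ring
  have hf0 : f 0 = 0 := by simp [hf]
  have hh : ∀ s > 0, h s = f (Real.log s) + h 1 := by
    intro s hs
    simp [hf, Real.exp_log hs]
  obtain ⟨r, hr⟩ : ∃ r, f r ≠ 0 := by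
    by_contra! h0
    obtain ⟨p, hp, q, hq, hlt⟩ := hn
    rw [hh p hp, hh q hq, h0, h0] at hlt
    exact hlt.false
  have hac : Continuous a := by
    have : a = fun x => (f (x + r) - f x) / f r := by
      funext x
      rw [hadd]
      field_simp
      ring
    rw [this]
    fun_prop
  -- Associativity of addition in the cocycle identity, with `f r ≠ 0` cancelled.
  have hmul : ∀ x y, a (x + y) = a x * a y := by
    intro x y
    have h1 := hadd (x + y) r
    rw [add_assoc, hadd x, hadd y r, hadd x y] at h1
    refine mul_right_cancel₀ hr ?_
    linarith
  have hlin : ∀ g : ℝ → ℝ, Continuous g → (∀ x y, g (x + y) = g x + g y) →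
      ∀ x, g x = g 1 * x := by
    intro g hg hga x
    have := map_real_smul (AddMonoidHom.mk' g hga) hg x 1
    simpa [mul_comm] using this
  set ρ := Real.log (a 1) with hρ
  have haexp : ∀ x, a x = Real.exp (ρ * x) := by
    intro x
    rw [hρ, ← hlin (fun x => Real.log (a x)) (hac.log fun x => (ha0 x).ne')
      (fun x y => by rw [hmul, Real.log_mul (ha0 x).ne' (ha0 y).ne']) x, Real.exp_log (ha0 x)]
  by_cases hρ0 : ρ = 0
  · have hf1 := hlin f hfc fun x y => by rw [hadd, haexp, hρ0]; simp [add_comm]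
    refine ⟨0, f 1, h 1, fun h0 => hr (by rw [hf1, h0, zero_mul]), fun s hs => ?_⟩
    rw [hh s hs, hf1]
    simp [kFun]
  · have hr0 : r ≠ 0 := fun h0 => hr (by rw [h0, hf0])
    have har : a r - 1 ≠ 0 := by
      rw [haexp, sub_ne_zero, Ne, Real.exp_eq_one_iff]
      exact mul_ne_zero hρ0 hr0
    refine ⟨ρ, ρ * f r / (a r - 1), h 1, div_ne_zero (mul_ne_zero hρ0 hr) har, fun s hs => ?_⟩
    -- Exchanging the two summands makes `f` proportional to `a - 1`.
    have h1 := hadd (Real.log s) r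
    rw [add_comm, hadd] at h1
    have h2 : f (Real.log s) * (a r - 1) = f r * (a (Real.log s) - 1) := by linarith
    rw [hh s hs, kFun, if_neg hρ0, Real.rpow_def_of_pos hs, mul_comm (Real.log s), ← haexp]
    field_simp
    linarith

section Core

variable {μ : Measure ℝ} [IsProbabilityMeasure μ]

/-- The normalizations at `ε` and `ε * t` both apply to `s ↦ Q (ε * (t * s))`, with limits `h (t *
s)` and `h s`; convergence of types gives the dilation equation. The additive constant of its
solution is absorbed into the centering. -/
theorem InMaxDomain.exists_tendsto_kFun (hμ : InMaxDomain μ) :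
    ∃ (ρ C : ℝ) (A B : ℝ → ℝ), C ≠ 0 ∧ (∀ ε, 0 < A ε) ∧ ∀ s, 0 < s → ∀ τ : ℝ → ℝ,
      Tendsto τ (𝓝[>] 0) (𝓝 s) →
      Tendsto (fun ε : ℝ => (expQuantile μ (ε * τ ε) - B ε) / A ε) (𝓝[>] 0)
        (𝓝 (C * kFun ρ s)) := by
  obtain ⟨A, B, h, hA, hh, hn, hlim⟩ := hμ.exists_tendsto_nhdsGT
  have hfe : ∀ t > 0, ∃ α > 0, ∃ β, ∀ s > 0, ContinuousAt h s → ContinuousAt h (t * s) →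
      h (t * s) = α * h s + β := by
    intro t ht
    have hanti : AntitoneOn (fun s => h (t * s)) (Ioi 0) := fun x hx y hy hxy =>
      hh (mul_pos ht hx) (mul_pos ht hy) (by gcongr)
    have hcount : ({s | 0 < s ∧ ¬ContinuousAt h s} ∪
        ((fun x => t * x) ⁻¹' {s | 0 < s ∧ ¬ContinuousAt h s})).Countable :=
      (countable_not_continuousAt_of_antitoneOn hh).union
        ((countable_not_continuousAt_of_antitoneOn hh).preimage (mul_right_injective₀ ht.ne'))
    have hD : Dense {s | 0 < s → ContinuousAt h s ∧ ContinuousAt h (t * s)} := by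
      refine (hcount.dense_compl ℝ).mono fun s hs hs0 => ?_
      have hs0' := mul_pos ht hs0
      simpa only [mem_compl_iff, mem_union, mem_preimage, mem_ofPred_eq, hs0, hs0', true_and,
        not_or, not_not] using hs
    have hdil : Tendsto (fun ε : ℝ => ε * t) (𝓝[>] 0) (𝓝[>] 0) := by
      refine tendsto_nhdsWithin_iff.2 ⟨?_, ?_⟩
      · have : Tendsto (fun ε : ℝ => ε * t) (𝓝 0) (𝓝 (0 * t)) := tendsto_id.mul_const t
        rw [zero_mul] at this
        exact this.mono_left nhdsWithin_le_nhds
      · filter_upwards [self_mem_nhdsWithin] with ε hε using mul_pos hε ht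
    obtain ⟨α, hα, β, hαβ⟩ := exists_affine_of_tendsto (l := 𝓝[>] (0 : ℝ))
      (X := fun ε s => expQuantile μ (ε * (t * s))) (A' := A) (B' := B)
      (A := fun ε => A (ε * t)) (B := fun ε => B (ε * t)) (f := h) (g := fun s => h (t * s))
      (D := {s ∈ {s | 0 < s → ContinuousAt h s ∧ ContinuousAt h (t * s)} | 0 < s})
      (Eventually.of_forall fun ε => hA _) (Eventually.of_forall fun ε => hA _)
      (fun s hs => ((hlim s hs.2 (hs.1 hs.2).1 (fun _ => s) tendsto_const_nhds).comp hdil).congr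
        fun ε => by simp only [Function.comp_apply, mul_assoc])
      (fun s hs => hlim (t * s) (mul_pos ht hs.2) (hs.1 hs.2).2 (fun _ => t * s)
        tendsto_const_nhds)
      (exists_ne_of_dense hh hn hD)
      (exists_ne_of_dense hanti (by
        obtain ⟨p, hp, q, hq, hlt⟩ := hn
        refine ⟨p / t, div_pos hp ht, q / t, div_pos hq ht, ?_⟩
        rwa [mul_div_cancel₀ _ ht.ne', mul_div_cancel₀ _ ht.ne']) hD)
    exact ⟨α, hα, β, fun s hs h1 h2 => hαβ s ⟨fun _ => ⟨h1, h2⟩, hs⟩⟩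
  have hcont : ∀ s > 0, ContinuousAt h s := fun s hs =>
    continuousAt_of_affine_dilation hh (fun t ht => by
      obtain ⟨α, -, β, hαβ⟩ := hfe t ht
      exact ⟨α, β, hαβ⟩) hs
  obtain ⟨ρ, C, d, hC, hk⟩ := exists_eq_kFun hcont hn fun t ht => by
    obtain ⟨α, hα, β, hαβ⟩ := hfe t ht
    exact ⟨α, hα, β, fun s hs => hαβ s hs (hcont s hs) (hcont _ (mul_pos ht hs))⟩
  refine ⟨ρ, C, A, fun ε => B ε + d * A ε, hC, hA, fun s hs τ hτ => ?_⟩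
  have h1 := (hlim s hs (hcont s hs) τ hτ).sub_const d
  rw [hk s hs, add_sub_cancel_right] at h1
  refine h1.congr fun ε => ?_
  have := (hA ε).ne'
  field_simp
  ring

end Core

/-! ### The functions `kFun ρ` and quantiles near level one -/

section KFun

@[simp] theorem kFun_one (ρ : ℝ) : kFun ρ 1 = 0 := by simp [kFun]

theorem injOn_kFun (ρ : ℝ) : InjOn (kFun ρ) (Ioi 0) := by
  intro s hs t ht hst
  simp only [kFun] at hst
  split_ifs at hst with h
  · exact Real.log_injOn_pos hs ht hst
  · rw [div_left_inj' h, sub_left_inj] at hst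
    exact (Real.rpow_left_inj (le_of_lt hs) (le_of_lt ht) h).1 hst

theorem kFun_ne_zero (ρ : ℝ) {v : ℝ} (hv : 0 < v) (hv1 : v ≠ 1) : kFun ρ v ≠ 0 := fun h =>
  hv1 (injOn_kFun ρ hv (mem_Ioi.2 one_pos) (h.trans (kFun_one ρ).symm))

@[fun_prop] theorem measurable_kFun (ρ : ℝ) : Measurable (kFun ρ) := by
  unfold kFun
  split_ifs <;> fun_prop

end KFun

/-- Derivative at `0`. It passes between the levels `1 - ε * s` and `exp (-ε * τ)` with `τ → s`. -/
theorem tendsto_neg_log_one_sub_mul_div (s : ℝ) :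
    Tendsto (fun ε : ℝ => -Real.log (1 - ε * s) / ε) (𝓝[>] 0) (𝓝 s) := by
  have h : HasDerivAt (fun ε : ℝ => -Real.log (1 - ε * s)) s 0 := by
    have h1 : HasDerivAt (fun ε : ℝ => 1 - ε * s) (-s) 0 := by
      simpa using ((hasDerivAt_id (0 : ℝ)).mul_const s).const_sub 1
    simpa only [zero_mul, sub_zero, div_one, neg_neg] using (h1.log (by simp)).fun_neg
  have h2 := (hasDerivAt_iff_tendsto_slope_zero.1 h).mono_left (nhdsGT_le_nhdsNE 0)
  simpa [div_eq_inv_mul] using h2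

theorem eventually_mul_lt_one (s : ℝ) : ∀ᶠ ε in 𝓝[>] (0 : ℝ), ε * s < 1 := by
  have : Tendsto (fun ε : ℝ => ε * s) (𝓝 0) (𝓝 (0 * s)) := tendsto_id.mul_const s
  rw [zero_mul] at this
  exact nhdsWithin_le_nhds (this.eventually_lt_const one_pos)

theorem eventually_quantile_one_sub (μ : Measure ℝ) (s : ℝ) : ∀ᶠ ε in 𝓝[>] (0 : ℝ),
    expQuantile μ (ε * (-Real.log (1 - ε * s) / ε)) = quantile μ (1 - ε * s) := by
  filter_upwards [eventually_mul_lt_one s, self_mem_nhdsWithin] with ε h1 h2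
  rw [expQuantile, mul_div_cancel₀ _ (ne_of_gt h2), neg_neg, Real.exp_log (by linarith)]

theorem eventually_quantile_one_sub_le (μ : Measure ℝ) {r s : ℝ} (hr : 0 < r) (hrs : r ≤ s) :
    ∀ᶠ ε in 𝓝[>] (0 : ℝ), quantile μ (1 - ε * s) ≤ quantile μ (1 - ε * r) := by
  filter_upwards [eventually_mul_lt_one s, self_mem_nhdsWithin] with ε h1 (h2 : 0 < ε)
  have := mul_pos h2 hr
  exact quantile_mono (by linarith) (by linarith) (by gcongr)

theorem tendsto_one_div_natCast_nhdsGT_zero :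
    Tendsto (fun n : ℕ => 1 / (n : ℝ)) atTop (𝓝[>] 0) := by
  simp only [one_div]
  exact tendsto_inv_atTop_nhdsGT_zero.comp tendsto_natCast_atTop_atTop

theorem tendsto_ratio_of_tendsto_normalized {ι : Type*} {l : Filter ι} {X Y Z A B : ι → ℝ}
    {x y z : ℝ} (hA : ∀ i, 0 < A i) (hX : Tendsto (fun i => (X i - B i) / A i) l (𝓝 x))
    (hY : Tendsto (fun i => (Y i - B i) / A i) l (𝓝 y))
    (hZ : Tendsto (fun i => (Z i - B i) / A i) l (𝓝 z)) (hzy : z ≠ y) :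
    (∀ᶠ i in l, Z i - Y i ≠ 0) ∧
      Tendsto (fun i => (X i - Y i) / (Z i - Y i)) l (𝓝 ((x - y) / (z - y))) := by
  have h1 := hZ.sub hY
  have hne := h1.eventually_ne (sub_ne_zero.2 hzy)
  refine ⟨hne.mono fun i hi h0 => hi ?_,
    ((hX.sub hY).div h1 (sub_ne_zero.2 hzy)).congr fun i => ?_⟩
  · rw [← sub_div, sub_sub_sub_cancel_right, h0, zero_div]
  · rw [Pi.div_apply, ← sub_div, ← sub_div, sub_sub_sub_cancel_right, sub_sub_sub_cancel_right,
      div_div_div_cancel_right₀ (hA i).ne']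

/-! ### The distribution function of the limit -/

section LimitLaw

theorem limitCdf_mem_Icc (ρ x : ℝ) : limitCdf ρ x ∈ Icc 0 1 := by
  have h : ∀ y : ℝ, 0 ≤ y → Real.exp (-y) ∈ Icc (0 : ℝ) 1 := fun y hy =>
    ⟨(Real.exp_pos _).le, by simpa using hy⟩
  unfold limitCdf frechetCdf gumbelCdf weibullCdf
  split_ifs with h1 h2 h3 h4
  · simp
  · exact h _ (Real.rpow_nonneg (not_le.1 h2).le _)
  · exact h _ (Real.exp_pos _).le
  · exact h _ (Real.rpow_nonneg (by linarith) _)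
  · simp

/-- In each case the inequality is solved for `w`; off the support of the Fréchet or Weibull law, it
fails or holds for every `w > 0`. -/
theorem neg_kFun_div_le_iff (ρ x : ℝ) {w : ℝ} (hw : 0 < w) :
    -(kFun ρ w / kFun ρ 2) ≤ x ↔ Real.exp (-w) ≤ limitCdf ρ x := by
  rcases lt_trichotomy ρ 0 with hρ | rfl | hρ
  · have h2 : (2 : ℝ) ^ ρ < 1 := Real.rpow_lt_one_of_one_lt_of_neg one_lt_two hρ
    have hk : -(kFun ρ w / kFun ρ 2) = (w ^ ρ - 1) / (1 - 2 ^ ρ) := by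
      rw [kFun, kFun, if_neg hρ.ne, if_neg hρ.ne, div_div_div_cancel_right₀ hρ.ne, ← div_neg,
        neg_sub]
    rw [hk, div_le_iff₀ (by linarith), limitCdf, if_pos hρ, frechetCdf]
    have hw' := Real.rpow_pos_of_pos hw ρ
    split_ifs with hy
    · refine iff_of_false ?_ (Real.exp_pos _).not_ge
      linarith
    · rw [Real.exp_le_exp, neg_le_neg_iff, show -(-1 / ρ) = ρ⁻¹ by rw [neg_div, neg_neg, one_div],
        Real.rpow_inv_le_iff_of_neg (not_le.1 hy) hw hρ]
      constructor <;> intro h <;> linarith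
  · have h2 : 0 < Real.log 2 := Real.log_pos one_lt_two
    rw [kFun, kFun, if_pos rfl, if_pos rfl, limitCdf, if_neg (lt_irrefl _), if_pos rfl, gumbelCdf,
      Real.exp_le_exp, neg_le_neg_iff, ← Real.le_log_iff_exp_le hw, ← neg_div, div_le_iff₀ h2]
    constructor <;> intro h <;> linarith
  · have h2 : 1 < (2 : ℝ) ^ ρ := Real.one_lt_rpow one_lt_two hρ
    rw [kFun, kFun, if_neg hρ.ne', if_neg hρ.ne', div_div_div_cancel_right₀ hρ.ne', ← neg_div,
      div_le_iff₀ (by linarith), limitCdf, if_neg hρ.not_gt, if_neg hρ.ne', weibullCdf]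
    have hw' := Real.rpow_pos_of_pos hw ρ
    split_ifs with hy
    · rw [Real.exp_le_exp, neg_le_neg_iff, one_div,
        Real.rpow_inv_le_iff_of_pos (by linarith) hw.le hρ]
      constructor <;> intro h <;> linarith
    · refine iff_of_true ?_ (by simpa using hw.le)
      linarith

theorem aemeasurable_neg_kFun_div (ρ : ℝ) :
    AEMeasurable (fun w => -(kFun ρ w / kFun ρ 2)) (expMeasure 1) := by
  fun_prop

/-- `kFun ρ` is injective on the half-line and the exponential law has no atoms. -/
theorem map_neg_kFun_div_singleton (ρ x : ℝ) :
    (expMeasure 1).map (fun w => -(kFun ρ w / kFun ρ 2)) {x} = 0 := by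
  have h2 := kFun_ne_zero ρ two_pos (by norm_num)
  rw [Measure.map_apply_of_aemeasurable (aemeasurable_neg_kFun_div ρ) (measurableSet_singleton x)]
  have hN : {w | 0 < w ∧ -(kFun ρ w / kFun ρ 2) = x}.Subsingleton := by
    rintro w ⟨hw, h⟩ w' ⟨hw', h'⟩
    have := h.trans h'.symm
    rw [neg_inj, div_left_inj' h2] at this
    exact injOn_kFun ρ hw hw' this
  refine measure_eq_zero_iff_ae_notMem.2 ?_
  filter_upwards [ae_pos_expMeasure, ae_expMeasure_of_countable hN.countable] with w hw hwN hx
  exact hwN ⟨hw, hx⟩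

theorem map_neg_kFun_div_real_Iic (ρ x : ℝ) :
    ((expMeasure 1).map (fun w => -(kFun ρ w / kFun ρ 2))).real (Iic x) = limitCdf ρ x := by
  obtain ⟨h0, h1⟩ := limitCdf_mem_Icc ρ x
  rw [map_measureReal_apply_of_aemeasurable (aemeasurable_neg_kFun_div ρ) measurableSet_Iic]
  refine Eq.trans ?_ (expMeasure_real_exp_neg_lt h0 h1)
  refine measureReal_congr ?_
  filter_upwards [ae_pos_expMeasure,
    ae_expMeasure_of_countable (countable_singleton (-Real.log (limitCdf ρ x)))] with w hw hne
  refine propext ?_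
  change -(kFun ρ w / kFun ρ 2) ≤ x ↔ Real.exp (-w) < limitCdf ρ x
  rw [neg_kFun_div_le_iff ρ x hw]
  refine ⟨fun h => h.lt_of_ne fun heq => hne ?_, le_of_lt⟩
  rw [mem_singleton_iff, ← heq, Real.log_exp, neg_neg]

end LimitLaw

/-! ### Uniqueness of the limit type and the converse -/

/-- An event of full exponential probability meets every nontrivial interval of `[0, ∞)`. -/
theorem exists_of_ae_expMeasure {p : ℝ → Prop} (h : ∀ᵐ w ∂(expMeasure 1), p w) {s t : ℝ}
    (hs : 0 ≤ s) (hst : s < t) : ∃ w, s < w ∧ w ≤ t ∧ p w := by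
  by_contra! hc
  have hle : ∀ r : ℝ, 0 ≤ r → Real.exp (-r) ≤ 1 := fun r hr => by simpa using hr
  have h1 := expMeasure_real_exp_neg_lt (Real.exp_pos (-s)).le (hle s hs)
  rw [measureReal_congr (t := {w | Real.exp (-w) < Real.exp (-t)}),
    expMeasure_real_exp_neg_lt (Real.exp_pos (-t)).le (hle t (hs.trans hst.le)), Real.exp_eq_exp]
    at h1
  · linarith
  · filter_upwards [h] with w hw
    refine propext ?_
    change Real.exp (-w) < Real.exp (-s) ↔ Real.exp (-w) < Real.exp (-t)
    rw [Real.exp_lt_exp, Real.exp_lt_exp, neg_lt_neg_iff, neg_lt_neg_iff]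
    exact ⟨fun hsw => not_le.1 fun hwt => hc w hsw hwt hw, hst.trans⟩

/-- Convergence of types against the `kFun` normalization determines the quantile transform of `ν`
at its continuity points, hence almost everywhere. -/
theorem exists_eq_map_kFun {μ ν : Measure ℝ} [IsProbabilityMeasure ν] (hν : Nondegenerate ν)
    {l : Filter ℕ} [l.NeBot] {a b A B : ℕ → ℝ} (ha : ∀ᶠ n in l, 0 < a n) (hA : ∀ n, 0 < A n)
    {ρ C : ℝ} (hC : C ≠ 0)
    (h : ∀ s, 0 < s → ContinuousAt (expQuantile ν) s →
      Tendsto (fun n : ℕ => (expQuantile μ (s / n) - b n) / a n) l (𝓝 (expQuantile ν s)))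
    (hk : ∀ s, 0 < s →
      Tendsto (fun n : ℕ => (expQuantile μ (s / n) - B n) / A n) l (𝓝 (C * kFun ρ s))) :
    ∃ c d : ℝ, c ≠ 0 ∧ ν = (expMeasure 1).map (fun w => c * kFun ρ w + d) := by
  have hD := dense_continuousAt_of_antitoneOn (antitoneOn_expQuantile ν) (antitoneOn_expQuantile ν)
  obtain ⟨α, hα, β, hαβ⟩ := exists_affine_of_tendsto (l := l)
    (X := fun n s => expQuantile μ (s / n)) (A' := a) (B' := b) (A := A) (B := B)
    (f := fun s => C * kFun ρ s) (g := expQuantile ν)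
    (D := {s ∈ {s | 0 < s → ContinuousAt (expQuantile ν) s ∧
      ContinuousAt (expQuantile ν) s} | 0 < s})
    (Eventually.of_forall hA) ha (fun s hs => hk s hs.2) (fun s hs => h s hs.2 (hs.1 hs.2).1)
    (by
      obtain ⟨s, hs, hs0, hs1⟩ := hD.exists_between one_pos
      obtain ⟨t, ht, ht1, -⟩ := hD.exists_between one_lt_two
      have ht0 := one_pos.trans ht1
      refine ⟨s, ⟨hs, hs0⟩, t, ⟨ht, ht0⟩, fun heq => (hs1.trans ht1).ne ?_⟩
      exact injOn_kFun ρ hs0 ht0 (mul_left_cancel₀ hC heq))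
    (exists_ne_of_dense (antitoneOn_expQuantile ν) hν.exists_expQuantile_lt hD)
  refine ⟨α * C, β, mul_ne_zero hα.ne' hC, (eq_map_expQuantile ν).trans (Measure.map_congr ?_)⟩
  filter_upwards [ae_pos_expMeasure, ae_expMeasure_of_countable
    (countable_not_continuousAt_of_antitoneOn (antitoneOn_expQuantile ν))] with s hs hsN
  have hsc : ContinuousAt (expQuantile ν) s := by_contra fun hc => hsN ⟨hs, hc⟩
  rw [hαβ s ⟨fun _ => ⟨hsc, hsc⟩, hs⟩, mul_assoc]

/-- The bounds `h0` and `h1` hold on sets of positive exponential probability, so the limit cannot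
be a point mass. -/
theorem inMaxDomain_of_tendsto {μ : Measure ℝ} [IsProbabilityMeasure μ] {a b : ℕ → ℝ}
    {h : ℝ → ℝ} (hanti : AntitoneOn h (Ioi 0)) {v : ℝ} (hv : 0 < v) (h0 : ∀ w, 1 < w → h w ≤ 0)
    (h1 : ∀ w, 0 < w → w < v → 1 ≤ h w) (ha : ∀ n, a n ≠ 0)
    (hlim : ∀ s, 0 < s → ContinuousAt h s →
      Tendsto (fun n : ℕ => (expQuantile μ (s / n) - b n) / a n) atTop (𝓝 (h s))) :
    InMaxDomain μ := by
  have hm := aemeasurable_expMeasure_of_antitoneOn hanti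
  have hprob := Measure.isProbabilityMeasure_map hm
  refine ⟨a, b, (expMeasure 1).map h, hprob, ha, fun c hc => ?_, ?_⟩
  · have hae : ∀ᵐ w ∂(expMeasure 1), h w = c := by
      refine ae_of_ae_map (p := fun x => x = c) hm ?_
      rw [hc]
      exact (ae_dirac_iff (measurableSet_singleton c)).2 rfl
    obtain ⟨w, hw, -, hwc⟩ := exists_of_ae_expMeasure hae zero_le_one one_lt_two
    obtain ⟨w', hw'0, hw'v, hw'c⟩ := exists_of_ae_expMeasure hae le_rfl (half_pos hv)
    linarith [h0 w hw, h1 w' hw'0 (hw'v.trans_lt (half_lt_self hv))]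
  · have key : NormalizedMaxTendsto μ a b h (expMeasure 1) := by
      refine normalizedMaxTendsto_of_ae_tendsto hm ?_
      filter_upwards [ae_pos_expMeasure, ae_expMeasure_of_countable
        (countable_not_continuousAt_of_antitoneOn hanti)] with s hs hsN
      exact hlim s hs (by_contra fun hc => hsN ⟨hs, hc⟩)
    refine ⟨key.forall_aemeasurable, measurable_id.aemeasurable, ?_⟩
    simpa only [Measure.map_id] using key.tendsto

/-- If the quantile ratios converge for a single `v < 1` and a dense set of `u`, then the law is
in a max-domain. -/
theorem inMaxDomain_of_dense {μ : Measure ℝ} [IsProbabilityMeasure μ] {v : ℝ} (hv0 : 0 < v)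
    (hv1 : v < 1) (hD : Dense {u | 0 < u → ∃ L, QuantileRatioTendsto μ u v L}) :
    InMaxDomain μ := by
  set D := {u | 0 < u → ∃ L, QuantileRatioTendsto μ u v L} with hDdef
  have hex : ∀ u ∈ D, 0 < u → ∃ L, QuantileRatioTendsto μ u v L := fun u hu => hu
  choose! L hL using hex
  set B : ℝ → ℝ := fun ε => quantile μ (1 - ε) with hB
  set A : ℝ → ℝ := fun ε => quantile μ (1 - ε * v) - quantile μ (1 - ε) with hA
  have hlim : ∀ u ∈ D, 0 < u → Tendsto (fun ε => (quantile μ (1 - ε * u) - B ε) / A ε) (𝓝[>] 0)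
      (𝓝 (L u)) := fun u hu hu0 => (hL u hu hu0).2
  -- As `v < 1`, monotonicity gives `0 ≤ A ε`; the nonvanishing denominator makes it strict.
  have hApos : ∀ᶠ ε in 𝓝[>] (0 : ℝ), 0 < A ε := by
    obtain ⟨u, hu, hu0, -⟩ := hD.exists_between one_pos
    filter_upwards [(hL u hu hu0).1, eventually_quantile_one_sub_le μ hv0 hv1.le] with ε h1 h2
    rw [mul_one] at h2
    exact lt_of_le_of_ne (sub_nonneg.2 h2) h1.symm
  have hLanti : ∀ r ∈ D, ∀ s ∈ D, 0 < r → r ≤ s → L s ≤ L r := by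
    intro r hr s hs hr0 hrs
    refine le_of_tendsto_of_tendsto (hlim s hs (hr0.trans_le hrs)) (hlim r hr hr0) ?_
    filter_upwards [hApos, eventually_quantile_one_sub_le μ hr0 hrs] with ε h1 h2
    gcongr
  have hLnonpos : ∀ r ∈ D, 1 ≤ r → L r ≤ 0 := by
    intro r hr hr1
    refine le_of_tendsto (hlim r hr (one_pos.trans_le hr1)) ?_
    filter_upwards [hApos, eventually_quantile_one_sub_le μ one_pos hr1] with ε h1 h2
    rw [mul_one] at h2
    exact div_nonpos_of_nonpos_of_nonneg (sub_nonpos.2 h2) h1.le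
  have hLone : ∀ r ∈ D, 0 < r → r ≤ v → 1 ≤ L r := by
    intro r hr hr0 hrv
    refine ge_of_tendsto (hlim r hr hr0) ?_
    filter_upwards [hApos, eventually_quantile_one_sub_le μ hr0 hrv] with ε h1 h2
    rw [one_le_div h1]
    exact sub_le_sub_right h2 _
  -- the antitone extension of `L` to the half-line
  set h : ℝ → ℝ := fun s => sSup (L '' {r ∈ D | s ≤ r}) with hh
  have hbdd : ∀ s > 0, BddAbove (L '' {r ∈ D | s ≤ r}) := by
    intro s hs
    obtain ⟨r₀, hr₀, hr₀0, hr₀s⟩ := hD.exists_between hs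
    refine ⟨L r₀, ?_⟩
    rintro _ ⟨r, ⟨hr, hsr⟩, rfl⟩
    exact hLanti r₀ hr₀ r hr hr₀0 (hr₀s.le.trans hsr)
  have hne : ∀ s, (L '' {r ∈ D | s ≤ r}).Nonempty := by
    intro s
    obtain ⟨r, hr, hsr, -⟩ := hD.exists_between (lt_add_one s)
    exact ⟨_, r, ⟨hr, hsr.le⟩, rfl⟩
  have hanti : AntitoneOn h (Ioi 0) := fun s hs t _ hst =>
    csSup_le_csSup (hbdd s hs) (hne t) (image_mono fun r hr => ⟨hr.1, hst.trans hr.2⟩)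
  have hhL : ∀ s ∈ D, 0 < s → h s = L s := by
    intro s hs hs0
    refine le_antisymm (csSup_le (hne s) ?_) (le_csSup (hbdd s hs0) ⟨s, ⟨hs, le_rfl⟩, rfl⟩)
    rintro _ ⟨r, ⟨hr, hsr⟩, rfl⟩
    exact hLanti s hs r hr hs0 hsr
  have hconv : ∀ s, 0 < s → ContinuousAt h s →
      Tendsto (fun ε : ℝ => (expQuantile μ (ε * s) - B ε) / A ε) (𝓝[>] 0) (𝓝 (h s)) := by
    intro s hs hc
    refine tendsto_of_antitoneOn_of_dense (l := 𝓝[>] (0 : ℝ))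
      (H := fun ε s => (expQuantile μ (ε * s) - B ε) / A ε) hD ?_ ?_ hs hc tendsto_const_nhds
    · filter_upwards [hApos, self_mem_nhdsWithin] with ε h1 (h2 : 0 < ε)
      exact antitoneOn_normalize (fun x hx y hy hxy =>
        antitoneOn_expQuantile μ (mul_pos h2 hx) (mul_pos h2 hy) (by gcongr)) h1 _
    · refine fun r hr hr0 => ⟨_, tendsto_neg_log_one_sub_mul_div r, ?_⟩
      rw [hhL r hr hr0]
      refine (hlim r hr hr0).congr' ?_
      filter_upwards [eventually_quantile_one_sub μ r] with ε hε
      rw [hε]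
  -- The value `1` only keeps the scale nonzero at the finitely many `n` where `A (1 / n)` may fail
  -- to be positive.
  refine inMaxDomain_of_tendsto (a := fun n => if 0 < A (1 / n) then A (1 / n) else 1)
    (b := fun n => B (1 / n)) hanti hv0 ?_ ?_ ?_ ?_
  · intro w hw
    refine csSup_le (hne w) ?_
    rintro _ ⟨r, ⟨hr, hwr⟩, rfl⟩
    exact hLnonpos r hr (hw.le.trans hwr)
  · intro w hw0 hwv
    obtain ⟨r, hr, hwr, hrv⟩ := hD.exists_between hwv
    exact (hLone r hr (hw0.trans hwr) hrv.le).trans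
      (le_csSup (hbdd w hw0) ⟨r, ⟨hr, hwr.le⟩, rfl⟩)
  · intro n
    split_ifs with h0
    · exact h0.ne'
    · exact one_ne_zero
  · intro s hs hsc
    refine ((hconv s hs hsc).comp tendsto_one_div_natCast_nhdsGT_zero).congr' ?_
    filter_upwards [tendsto_one_div_natCast_nhdsGT_zero.eventually hApos] with n hn
    rw [if_pos hn, Function.comp_apply, one_div_mul_eq_div]

theorem InMaxDomain.exists_index {μ : Measure ℝ} [IsProbabilityMeasure μ] (hμ : InMaxDomain μ) :
    ∃ ρ : ℝ,
      (∀ u v : ℝ, 0 < u → 0 < v → v ≠ 1 →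
        QuantileRatioTendsto μ u v (kFun ρ u / kFun ρ v)) ∧
      NormalizedMaxTendsto μ (normA μ) (normB μ) (fun w => kFun ρ w / kFun ρ 2) (expMeasure 1) ∧
      (∀ x : ℝ, Tendsto
        (fun n : ℕ => (sampleLaw μ n).real {y | (sampleMax n y - normB μ n) / |normA μ n| ≤ x})
        atTop (𝓝 (limitCdf ρ x))) ∧
      (∀ (a b : ℕ → ℝ) (ν : Measure ℝ) [IsProbabilityMeasure ν], IsMaxLimit μ a b ν →
        ∃ c d : ℝ, c ≠ 0 ∧ ν = (expMeasure 1).map (fun w => c * kFun ρ w + d)) := by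
  obtain ⟨ρ, C, A, B, hC, hA, hlim⟩ := hμ.exists_tendsto_kFun
  have hq : ∀ s, 0 < s → Tendsto (fun ε : ℝ => (quantile μ (1 - ε * s) - B ε) / A ε) (𝓝[>] 0)
      (𝓝 (C * kFun ρ s)) := by
    intro s hs
    refine (hlim s hs _ (tendsto_neg_log_one_sub_mul_div s)).congr' ?_
    filter_upwards [eventually_quantile_one_sub μ s] with ε hε
    rw [hε]
  have hq1 : Tendsto (fun ε : ℝ => (quantile μ (1 - ε) - B ε) / A ε) (𝓝[>] 0) (𝓝 0) := by
    simpa using hq 1 one_pos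
  have hne : ∀ v, 0 < v → v ≠ 1 → C * kFun ρ v ≠ 0 := fun v hv hv1 =>
    mul_ne_zero hC (kFun_ne_zero ρ hv hv1)
  have hratio : ∀ u v : ℝ, 0 < u → 0 < v → v ≠ 1 →
      QuantileRatioTendsto μ u v (kFun ρ u / kFun ρ v) := by
    intro u v hu hv hv1
    have := tendsto_ratio_of_tendsto_normalized hA (hq u hu) hq1 (hq v hv) (hne v hv hv1)
    rwa [sub_zero, sub_zero, mul_div_mul_left _ _ hC] at this
  have hV : ∀ s, 0 < s → Tendsto (fun n : ℕ => (expQuantile μ (s / n) - B (1 / n)) / A (1 / n))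
      atTop (𝓝 (C * kFun ρ s)) := fun s hs =>
    ((hlim s hs (fun _ => s) tendsto_const_nhds).comp tendsto_one_div_natCast_nhdsGT_zero).congr
      fun n => by rw [Function.comp_apply, one_div_mul_eq_div]
  have hnormA : ∀ n : ℕ, normA μ n = quantile μ (1 - 1 / n * 2) - quantile μ (1 - 1 / n) :=
    fun n => by rw [normA, one_div_mul_eq_div]
  have hlaw : NormalizedMaxTendsto μ (normA μ) (normB μ) (fun w => kFun ρ w / kFun ρ 2)
      (expMeasure 1) := by
    refine normalizedMaxTendsto_of_ae_tendsto (by fun_prop) ?_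
    filter_upwards [ae_pos_expMeasure] with s hs
    have := (tendsto_ratio_of_tendsto_normalized (fun n : ℕ => hA (1 / n)) (hV s hs)
      (hq1.comp tendsto_one_div_natCast_nhdsGT_zero)
      ((hq 2 two_pos).comp tendsto_one_div_natCast_nhdsGT_zero)
      (hne 2 two_pos (by norm_num))).2
    rw [sub_zero, sub_zero, mul_div_mul_left _ _ hC] at this
    refine this.congr fun n => ?_
    rw [hnormA, normB]
  refine ⟨ρ, hratio, hlaw, fun x => ?_, fun a b ν _ hν => ?_⟩
  · have hneg : ∀ᶠ n : ℕ in atTop, normA μ n < 0 := by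
      filter_upwards [tendsto_one_div_natCast_nhdsGT_zero.eventually
        (eventually_quantile_one_sub_le μ one_pos one_le_two),
        tendsto_one_div_natCast_nhdsGT_zero.eventually
          (hratio 1 2 one_pos two_pos (by norm_num)).1] with n h1 h2
      rw [mul_one] at h1
      rw [hnormA]
      exact lt_of_le_of_ne (sub_nonpos.2 h1) h2
    -- Since `normA μ n` is eventually negative, dividing by its absolute value reflects the limit.
    have := tendsto_real_le_of_tendstoInDistribution (hlaw.continuous_comp continuous_neg)
      (map_neg_kFun_div_singleton ρ x)
    rw [show (Neg.neg ∘ fun w => kFun ρ w / kFun ρ 2) = fun w => -(kFun ρ w / kFun ρ 2) from rfl,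
      map_neg_kFun_div_real_Iic] at this
    refine this.congr' ?_
    filter_upwards [hneg] with n hn
    simp only [Function.comp_apply, abs_of_neg hn, div_neg]
  -- A subsequence of positive scales already identifies `ν`; if there is none, the scales are
  -- eventually negative and the reflection of `ν` is identified instead.
  · by_cases hp : ∃ᶠ n in atTop, 0 < a n
    · have : (atTop ⊓ 𝓟 {n | 0 < a n}).NeBot := frequently_mem_iff_neBot.1 hp
      have hmem : ∀ᶠ n in atTop ⊓ 𝓟 {n | 0 < a n}, 0 < a n :=
        mem_inf_of_right (mem_principal_self _)
      exact exists_eq_map_kFun hν.2.1 hmem (fun n => hA (1 / n)) hC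
        (fun s hs hc => hν.tendsto_of_pos inf_le_left hmem hs hc)
        (fun s hs => (hV s hs).mono_left inf_le_left)
    · have hmem : ∀ᶠ n in atTop, a n < 0 := (not_frequently.1 hp).mono fun n hn =>
        lt_of_le_of_ne (not_lt.1 hn) (hν.1 n)
      have : IsProbabilityMeasure (ν.map Neg.neg) :=
        Measure.isProbabilityMeasure_map measurable_neg.aemeasurable
      obtain ⟨c, d, hc, hcd⟩ := exists_eq_map_kFun hν.2.1.map_neg
        (hmem.mono fun n hn => neg_pos.2 hn) (fun n => hA (1 / n)) hC
        (fun s hs hc => hν.tendsto_of_neg le_rfl hmem hs hc) hV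
      refine ⟨-c, -d, neg_ne_zero.2 hc, ?_⟩
      have := congrArg (Measure.map Neg.neg) hcd
      rw [Measure.map_map measurable_neg measurable_neg, Measure.map_map measurable_neg
        (by fun_prop), show (Neg.neg ∘ Neg.neg : ℝ → ℝ) = id from funext neg_neg,
        Measure.map_id] at this
      rw [this]
      congr 1
      funext w
      simp only [Function.comp_apply]
      ring

theorem theorem3p1 (μ : Measure ℝ) [IsProbabilityMeasure μ] :
    (InMaxDomain μ ↔
      ∀ᵐ p : ℝ × ℝ ∂((volume.restrict (Ioi (0 : ℝ))).prod (volume.restrict (Ioi (0 : ℝ)))),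
        ∃ L : ℝ, QuantileRatioTendsto μ p.1 p.2 L) ∧
    (InMaxDomain μ → ∃ ρ : ℝ,
      (∀ u v : ℝ, 0 < u → 0 < v → v ≠ 1 →
        QuantileRatioTendsto μ u v (kFun ρ u / kFun ρ v)) ∧
      NormalizedMaxTendsto μ (normA μ) (normB μ) (fun w => kFun ρ w / kFun ρ 2) (expMeasure 1) ∧
      (∀ x : ℝ, Tendsto
        (fun n : ℕ => (sampleLaw μ n).real {y | (sampleMax n y - normB μ n) / |normA μ n| ≤ x})
        atTop (𝓝 (limitCdf ρ x))) ∧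
      (∀ (a b : ℕ → ℝ) (ν : Measure ℝ) [IsProbabilityMeasure ν], IsMaxLimit μ a b ν →
        ∃ c d : ℝ, c ≠ 0 ∧ ν = (expMeasure 1).map (fun w => c * kFun ρ w + d))) := by
  refine ⟨⟨fun hμ => ?_, fun h => ?_⟩, fun hμ => hμ.exists_index⟩
  · obtain ⟨ρ, hρ, -⟩ := hμ.exists_index
    have hpos : ∀ᵐ x ∂(volume.restrict (Ioi (0 : ℝ))), 0 < x := ae_restrict_mem measurableSet_Ioi
    have hone : ∀ᵐ x ∂(volume.restrict (Ioi (0 : ℝ))), x ≠ 1 :=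
      ae_restrict_of_ae (Measure.ae_ne volume 1)
    filter_upwards [Measure.quasiMeasurePreserving_fst.ae hpos,
      Measure.quasiMeasurePreserving_snd.ae hpos,
      Measure.quasiMeasurePreserving_snd.ae hone] with p h1 h2 h3
    exact ⟨_, hρ _ _ h1 h2 h3⟩
  -- The swap lets Fubini fix `v` first; sets of full measure are dense, which yields some `v` in
  -- `(0, 1)` and then a dense set of `u`.
  · have h1 := Measure.ae_ae_of_ae_prod
      (Measure.measurePreserving_swap.quasiMeasurePreserving.ae h)
    obtain ⟨v, hv, hv0, hv1⟩ := (Measure.dense_of_ae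
      ((ae_restrict_iff' measurableSet_Ioi).1 h1)).exists_between one_pos
    exact inMaxDomain_of_dense hv0 hv1
      (Measure.dense_of_ae ((ae_restrict_iff' measurableSet_Ioi).1 (hv hv0)))
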